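/- Work in $\mathbb{Z}[x_1,x_2,\dots,y_1,y_2,\dots]$. Let $\partial_i f=\dfrac{f-f^{s_i}}{x_i-x_{i+1}}$, where $f^{s_i}$ is obtained from $f$ by exchanging $x_i$ and $x_{i+1}$, and let $\partial_{\omega_r}$ be the product of the $\partial_i$ along a reduced word of the longest permutation $\omega_r\in\mathfrak{S}_r$. Partitions are written increasingly. For a partition $\nu=[\nu_1\le\cdots\le\nu_r]\in\mathbb{N}^r$, put $\lambda=[\nu_r+r-1,\dots,\nu_2+1,\nu_1]$ and let $$\mathbb{Y}_\nu(\mathbf{x}^r,\mathbf{y})=\partial_{\omega_r}\Bigl(\prod_{i=1}^r\prod_{j=1}^{\lambda_i}(x_i-y_j)\Bigr),\qquad \mathbf{x}^r=[x_1,\dots,x_r],$$ be the Grassmannian Schubert polynomial of code $\nu$. The diagram of a partition is drawn with left-aligned rows of lengths $\nu_1,\dots,\nu_r$ from top to bottom. A partition $\mu\in\mathbb{N}^{r-1}$ is regarded as $[0,\mu_1,\dots,\mu_{r-1}]\in\mathbb{N}^r$. For $\zeta\in\mathbb{N}^r$ a partition whose diagram contains that of $\mu$, $\zeta/\mu$ is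 a ribbon if it contains no $2\times2$ square of boxes. The box in row $i$ (from the top) and column $j$ has number $c(\square)=i+j-1$. A box of $\zeta/\mu$ is terminal if it is the rightmost box of $\zeta/\mu$ in its row. The weight $\theta(\zeta/\mu)$ of a ribbon is the product over its boxes $\square$ of - $x-y_{c(\square)}$ if $\square$ is not terminal; - $y_{c(\square)}$ if $\square$ is terminal and lies directly above another box of $\zeta/\mu$; - $x$ if $\square$ is terminal and does not lie directly above another box of $\zeta/\mu$. **Proposition.** Let $r\ge1$, let $\nu\in\mathbb{N}^r$ be a partition and let $\zeta=\nu+1^r=[\nu_1+1,\dots,\nu_r+1]$. Then, with $x=x_r$, $$x_1\cdots x_r\,\mathbb{Y}_\nu(\mathbf{x}^r,\mathbf{y})=\sum_{\mu}\theta(\zeta/\mu)\,\mathbb{Y}_\mu(\mathbf{x}^{r-1},\mathbf{y}),$$ where the sum runs over all partitions $\mu\in\mathbb{N}^{r-1}$ such that $\zeta/\mu$ is a ribbon. -/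

import Mathlib

noncomputable section

/-- The ring `ℤ[x_1, x_2, …, y_1, y_2, …]` (the variables of index `0` are never used). -/
abbrev XYPoly : Type := MvPolynomial (ℕ ⊕ ℕ) ℤ

/-- The variable `x_i`. -/
def xVar (i : ℕ) : XYPoly := MvPolynomial.X (Sum.inl i)

/-- The variable `y_j`. -/
def yVar (j : ℕ) : XYPoly := MvPolynomial.X (Sum.inr j)

/-- The exchange `f ↦ f^{s_i}` of `x_i` and `x_{i+1}`, with all other variables fixed. -/
def swapVar (i : ℕ) : XYPoly →ₐ[ℤ] XYPoly :=
  MvPolynomial.rename (Sum.map (Equiv.swap i (i + 1)) id)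

theorem swapVar_sub_dvd (i : ℕ) (f : XYPoly) :
    xVar i - xVar (i + 1) ∣ f - swapVar i f := by
  induction f using MvPolynomial.induction_on with
  | C a => simp [swapVar]
  | add p q hp hq =>
    rw [map_add, add_sub_add_comm]
    exact dvd_add hp hq
  | mul_X p s hp =>
    have hs : xVar i - xVar (i + 1) ∣
        (MvPolynomial.X s : XYPoly) - swapVar i (MvPolynomial.X s) := by
      rcases s with k | k
      · by_cases h1 : k = i
        · subst h1
          simp [swapVar, xVar]
        · by_cases h2 : k = i + 1
          · subst h2
            simp only [swapVar, MvPolynomial.rename_X, Sum.map_inl, Equiv.swap_apply_right, xVar]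
            exact ⟨-1, by ring⟩
          · simp [swapVar, Equiv.swap_apply_of_ne_of_ne h1 h2]
      · simp [swapVar]
    rw [map_mul]
    have e : p * MvPolynomial.X s - swapVar i p * swapVar i (MvPolynomial.X s)
        = (p - swapVar i p) * MvPolynomial.X s
          + swapVar i p * (MvPolynomial.X s - swapVar i (MvPolynomial.X s)) := by ring
    rw [e]
    exact dvd_add (hp.mul_right _) (hs.mul_left _)

/-- The Newton divided difference `∂_i f = (f - f^{s_i}) / (x_i - x_{i+1})`: the quotient, which
is unique because `XYPoly` is a domain. -/
def divDiff (i : ℕ) (f : XYPoly) : XYPoly := Classical.choose (swapVar_sub_dvd i f)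

theorem divDiff_spec (i : ℕ) (f : XYPoly) :
    f - swapVar i f = (xVar i - xVar (i + 1)) * divDiff i f :=
  Classical.choose_spec (swapVar_sub_dvd i f)

/-- A reduced word of the longest permutation `ω_r = [r, …, 1]` in the simple transpositions:
`ω_{r+1} = s_1 s_2 ⋯ s_r ω_r`. -/
def longestWord : ℕ → List ℕ
  | 0 => []
  | r + 1 => (List.range r).map (· + 1) ++ longestWord r

/-- The divided difference `∂_{ω_r}`, the product of the `∂_i` along a reduced word of `ω_r`. -/
def divDiffLongest (r : ℕ) (f : XYPoly) : XYPoly := (longestWord r).foldr divDiff f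

/-- `∏_{i=1}^{r} ∏_{j=1}^{v_i} (x_i - y_j)`; for weakly decreasing `v` this is the dominant
Schubert polynomial of code `v`. -/
def dominantPoly {r : ℕ} (v : Fin r → ℕ) : XYPoly :=
  ∏ i : Fin r, ∏ j ∈ Finset.range (v i), (xVar ((i : ℕ) + 1) - yVar (j + 1))

/-- For `ν_1 ≤ ⋯ ≤ ν_r`, the Grassmannian Schubert polynomial `𝕐_ν(x^r, y)`: the image under
`∂_{ω_r}` of the dominant Schubert polynomial of code `[ν_r + r - 1, …, ν_2 + 1, ν_1]`. -/
def grassSchubert {r : ℕ} (ν : Fin r → ℕ) : XYPoly :=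
  divDiffLongest r (dominantPoly fun i => ν i.rev + (i.rev : ℕ))

/-- The diagram of `v`: rows are listed from top to bottom, and row `i` consists of the `v i`
leftmost boxes. A box is a pair (row, column), both counted from `0`. -/
def rowDiagram {r : ℕ} (v : Fin r → ℕ) : Finset (ℕ × ℕ) :=
  Finset.univ.biUnion fun i : Fin r => {(i : ℕ)} ×ˢ Finset.range (v i)

/-- The boxes of `ζ/μ`. -/
def skewBoxes {r : ℕ} (ζ μ : Fin r → ℕ) : Finset (ℕ × ℕ) := rowDiagram ζ \ rowDiagram μ

/-- `ζ/μ` is a ribbon: the diagram of `ζ` contains that of `μ`, and the difference contains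
no `2 × 2` square. -/
def IsRibbon {r : ℕ} (ζ μ : Fin r → ℕ) : Prop :=
  (∀ i, μ i ≤ ζ i) ∧
    ¬ ∃ i j : ℕ, (i, j) ∈ skewBoxes ζ μ ∧ (i, j + 1) ∈ skewBoxes ζ μ ∧
      (i + 1, j) ∈ skewBoxes ζ μ ∧ (i + 1, j + 1) ∈ skewBoxes ζ μ

/-- The number of the diagonal of a box: `1` for the top leftmost box, increasing by one with
each step to the right or downwards. -/
def boxNumber (b : ℕ × ℕ) : ℕ := b.1 + b.2 + 1

/-- `b` is the rightmost box of its row in `ζ/μ`. -/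
def IsTerminalBox {r : ℕ} (ζ μ : Fin r → ℕ) (b : ℕ × ℕ) : Prop :=
  ∀ b' ∈ skewBoxes ζ μ, b'.1 = b.1 → b'.2 ≤ b.2

open Classical in
/-- The weight of a box of the ribbon `ζ/μ`. -/
def boxWeight {A : Type*} [CommRing A] (x : A) (y : ℕ → A) {r : ℕ} (ζ μ : Fin r → ℕ)
    (b : ℕ × ℕ) : A :=
  if ¬ IsTerminalBox ζ μ b then x - y (boxNumber b)
  else if (b.1 + 1, b.2) ∈ skewBoxes ζ μ then y (boxNumber b)
  else x

/-- The weight `θ(ζ/μ)` of a ribbon. -/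
def ribbonWeight {A : Type*} [CommRing A] (x : A) (y : ℕ → A) {r : ℕ} (ζ μ : Fin r → ℕ) : A :=
  ∏ b ∈ skewBoxes ζ μ, boxWeight x y ζ μ b

/-- `μ ∈ ℕ^n` seen in `ℕ^{n+1}` with a first part `0`; the diagram has an empty top row, and the
largest parts stay in the bottom row. -/
def padTop {n : ℕ} (μ : Fin n → ℕ) : Fin (n + 1) → ℕ := Fin.cons 0 μ

/-- The partitions `μ ∈ ℕ^n` such that `ζ/μ` is a ribbon, for `ζ ∈ ℕ^{n+1}`. -/
def ribbonPartitions {n : ℕ} (ζ : Fin (n + 1) → ℕ) : Set (Fin n → ℕ) :=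
  {μ | Monotone μ ∧ IsRibbon ζ (padTop μ)}

theorem ribbonPartitions_finite {n : ℕ} (ζ : Fin (n + 1) → ℕ) : (ribbonPartitions ζ).Finite :=
  (Set.finite_Iic fun i : Fin n => ζ i.succ).subset fun _ hμ i => by
    simpa [padTop] using hμ.2.1 i.succ

end

noncomputable section

/-! ### Divided differences -/

/-! Write (t|m) = (t - y_1)⋯(t - y_m). By the bialternant formula `grassSchubert_mul_xVandermonde`,
𝕐_ν times the Vandermonde determinant is det (x_k|ν_i + i), with columns counted from 0. It rests on
∂_k being self-adjoint under antisymmetrization, which gives access to ∂_{ω_r} without an explicit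
formula for it.

Multiply row k of the alternant by x_k and clear the last row, except its first entry, by column
operations. In the remaining minor, row k is divisible by x_k - x_r, and these factors account, up
to sign, for the quotient of the Vandermonde determinants in r and r - 1 variables. The quotient
entries expand in the (t|s) (`sub_mul_sum_branchCoeff`), so multilinearity yields alternants in r -
1 variables (`prod_xVar_mul_alternant`). Exponent tuples with a repetition contribute 0; the others
are the μ + (0, 1, …) with ζ/μ a ribbon, and their coefficients multiply to θ(ζ/μ)
(`ribbonWeight_padTop`, `sum_ribbonPartitions`). -/

@[simp] theorem swapVar_xVar_left (i : ℕ) : swapVar i (xVar i) = xVar (i + 1) := by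
  simp [swapVar, xVar]

@[simp] theorem swapVar_xVar_right (i : ℕ) : swapVar i (xVar (i + 1)) = xVar i := by
  simp [swapVar, xVar]

theorem swapVar_xVar_of_ne {i j : ℕ} (h1 : j ≠ i) (h2 : j ≠ i + 1) :
    swapVar i (xVar j) = xVar j := by
  simp [swapVar, xVar, Equiv.swap_apply_of_ne_of_ne h1 h2]

theorem xVar_injective : Function.Injective xVar := fun i j h => by
  simpa [xVar] using MvPolynomial.X_injective h

theorem xVar_sub_ne_zero {i j : ℕ} (h : i ≠ j) : xVar i - xVar j ≠ 0 :=
  sub_ne_zero.2 fun e => h (xVar_injective e)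

@[simp] theorem swapVar_swapVar (i : ℕ) (f : XYPoly) : swapVar i (swapVar i f) = f := by
  simp only [swapVar, MvPolynomial.rename_rename, Sum.map_comp_map]
  have : (⇑(Equiv.swap i (i + 1)) ∘ ⇑(Equiv.swap i (i + 1))) = id := by
    funext k; simp
  simp [this]

theorem swapVar_comm {i j : ℕ} (h : i + 2 ≤ j) (f : XYPoly) :
    swapVar i (swapVar j f) = swapVar j (swapVar i f) := by
  simp only [swapVar, MvPolynomial.rename_rename, Sum.map_comp_map]
  have : (⇑(Equiv.swap i (i + 1)) ∘ ⇑(Equiv.swap j (j + 1)))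
      = (⇑(Equiv.swap j (j + 1)) ∘ ⇑(Equiv.swap i (i + 1))) := by
    funext k
    simp only [Function.comp_apply, Equiv.swap_apply_def]
    split_ifs <;> omega
  rw [this]

theorem swapVar_braid (i : ℕ) (f : XYPoly) :
    swapVar i (swapVar (i + 1) (swapVar i f))
      = swapVar (i + 1) (swapVar i (swapVar (i + 1) f)) := by
  simp only [swapVar, MvPolynomial.rename_rename, Sum.map_comp_map]
  have : (⇑(Equiv.swap i (i + 1)) ∘ ⇑(Equiv.swap (i + 1) (i + 1 + 1)) ∘ ⇑(Equiv.swap i (i + 1)))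
      = (⇑(Equiv.swap (i + 1) (i + 1 + 1)) ∘ ⇑(Equiv.swap i (i + 1)) ∘
        ⇑(Equiv.swap (i + 1) (i + 1 + 1))) := by
    funext k
    simp only [Function.comp_apply, Equiv.swap_apply_def]
    split_ifs <;> omega
  simp only [← Function.comp_assoc] at this ⊢
  rw [this]

theorem divDiff_eq_of {i : ℕ} {f g : XYPoly}
    (h : f - swapVar i f = (xVar i - xVar (i + 1)) * g) : divDiff i f = g :=
  mul_left_cancel₀ (xVar_sub_ne_zero (Nat.succ_ne_self i).symm) ((divDiff_spec i f).symm.trans h)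

theorem divDiff_of_swapVar_eq {i : ℕ} {f : XYPoly} (h : swapVar i f = f) : divDiff i f = 0 :=
  divDiff_eq_of (by rw [h]; simp)

theorem swapVar_eq_of_divDiff {i : ℕ} {f : XYPoly} (h : divDiff i f = 0) : swapVar i f = f := by
  have := divDiff_spec i f
  rw [h, mul_zero, sub_eq_zero] at this
  exact this.symm

@[simp] theorem divDiff_zero (i : ℕ) : divDiff i 0 = 0 := divDiff_of_swapVar_eq (map_zero _)

theorem swapVar_divDiff (i : ℕ) (f : XYPoly) : swapVar i (divDiff i f) = divDiff i f := by
  have h := congrArg (swapVar i) (divDiff_spec i f)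
  simp only [map_sub, map_mul, swapVar_swapVar, swapVar_xVar_left, swapVar_xVar_right] at h
  refine (divDiff_eq_of ?_).symm
  linear_combination -h

@[simp] theorem divDiff_divDiff (i : ℕ) (f : XYPoly) : divDiff i (divDiff i f) = 0 :=
  divDiff_of_swapVar_eq (swapVar_divDiff i f)

theorem divDiff_mul_of_swapVar_eq {i : ℕ} {c : XYPoly} (h : swapVar i c = c) (f : XYPoly) :
    divDiff i (c * f) = c * divDiff i f :=
  divDiff_eq_of (by rw [map_mul, h]; linear_combination c * divDiff_spec i f)

theorem divDiff_xVar (i : ℕ) : divDiff i (xVar i) = 1 :=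
  divDiff_eq_of (by simp)

theorem divDiff_comm {i j : ℕ} (h : i + 2 ≤ j) (f : XYPoly) :
    divDiff i (divDiff j f) = divDiff j (divDiff i f) := by
  have e1 := divDiff_spec i f
  have e2 := divDiff_spec j f
  have e3 := divDiff_spec j (divDiff i f)
  have e1' := congrArg (swapVar j) e1
  have e2' := congrArg (swapVar i) e2
  simp only [map_sub, map_mul, swapVar_comm h, swapVar_xVar_of_ne (show j ≠ i by omega)
    (show j ≠ i + 1 by omega), swapVar_xVar_of_ne (show j + 1 ≠ i by omega)
    (show j + 1 ≠ i + 1 by omega), swapVar_xVar_of_ne (show i ≠ j by omega)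
    (show i ≠ j + 1 by omega), swapVar_xVar_of_ne (show i + 1 ≠ j by omega)
    (show i + 1 ≠ j + 1 by omega)] at e1' e2'
  refine divDiff_eq_of (mul_left_cancel₀ (xVar_sub_ne_zero (Nat.succ_ne_self j).symm) ?_)
  linear_combination e1 - e1' - e2 + e2' + (xVar i - xVar (i + 1)) * e3

/-- Times (x_i - x_{i+1})(x_i - x_{i+2})(x_{i+1} - x_{i+2}), both sides become the alternating sum
of f over the permutations of the three variables. -/
theorem divDiff_braid (i : ℕ) (f : XYPoly) :
    divDiff (i + 1) (divDiff i (divDiff (i + 1) f))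
      = divDiff i (divDiff (i + 1) (divDiff i f)) := by
  have hx : swapVar (i + 1) (xVar i) = xVar i := swapVar_xVar_of_ne (by omega) (by omega)
  have hz : swapVar i (xVar (i + 2)) = xVar (i + 2) := swapVar_xVar_of_ne (by omega) (by omega)
  have hy : swapVar (i + 1) (xVar (i + 1)) = xVar (i + 2) := swapVar_xVar_left (i + 1)
  have hw : swapVar (i + 1) (xVar (i + 2)) = xVar (i + 1) := swapVar_xVar_right (i + 1)
  have key1 : (xVar i - xVar (i + 1)) * ((xVar i - xVar (i + 2)) * ((xVar (i + 1) - xVar (i + 2)) *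
      divDiff i (divDiff (i + 1) (divDiff i f)))) =
      f - swapVar i f - swapVar (i + 1) f + swapVar (i + 1) (swapVar i f)
        + swapVar i (swapVar (i + 1) f) - swapVar i (swapVar (i + 1) (swapVar i f)) := by
    have a1 := divDiff_spec i f
    have a2 := divDiff_spec (i + 1) (divDiff i f)
    have a3 := divDiff_spec i (divDiff (i + 1) (divDiff i f))
    have b1 := congrArg (swapVar (i + 1)) a1
    have b2 := congrArg (swapVar i) a2
    have c1 := congrArg (swapVar i) b1
    simp only [map_sub, map_mul, hx, hy, hz, swapVar_xVar_left, swapVar_xVar_right,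
      swapVar_divDiff] at b1 b2 c1
    refine mul_left_cancel₀ (xVar_sub_ne_zero (Nat.succ_ne_self i).symm) ?_
    linear_combination -((xVar i - xVar (i + 1)) * (xVar i - xVar (i + 2)) * (xVar (i + 1) - xVar (i + 2))) * a3
      - (xVar i - xVar (i + 2)) * (xVar i - xVar (i + 1)) * a2 - (xVar i - xVar (i + 2)) * a1
      + (xVar i - xVar (i + 1)) * b1 + (xVar i - xVar (i + 1)) * (xVar (i + 1) - xVar (i + 2)) * b2
      + (xVar (i + 1) - xVar (i + 2)) * a1 - (xVar i - xVar (i + 1)) * c1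
  have key2 : (xVar i - xVar (i + 1)) * ((xVar i - xVar (i + 2)) * ((xVar (i + 1) - xVar (i + 2)) *
      divDiff (i + 1) (divDiff i (divDiff (i + 1) f)))) =
      f - swapVar i f - swapVar (i + 1) f + swapVar (i + 1) (swapVar i f)
        + swapVar i (swapVar (i + 1) f) - swapVar (i + 1) (swapVar i (swapVar (i + 1) f)) := by
    have a1 := divDiff_spec (i + 1) f
    have a2 := divDiff_spec i (divDiff (i + 1) f)
    have a3 := divDiff_spec (i + 1) (divDiff i (divDiff (i + 1) f))
    have b1 := congrArg (swapVar i) a1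
    have b2 := congrArg (swapVar (i + 1)) a2
    have c1 := congrArg (swapVar (i + 1)) b1
    simp only [map_sub, map_mul, hx, hy, hz, hw, swapVar_xVar_right,
      swapVar_divDiff] at b1 b2 c1
    refine mul_left_cancel₀ (xVar_sub_ne_zero (Nat.succ_ne_self (i + 1)).symm) ?_
    linear_combination -((xVar i - xVar (i + 1)) * (xVar i - xVar (i + 2)) * (xVar (i + 1) - xVar (i + 2))) * a3
      - (xVar i - xVar (i + 2)) * (xVar (i + 1) - xVar (i + 2)) * a2 - (xVar i - xVar (i + 2)) * a1
      + (xVar (i + 1) - xVar (i + 2)) * b1 + (xVar i - xVar (i + 1)) * (xVar (i + 1) - xVar (i + 2)) * b2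
      + (xVar i - xVar (i + 1)) * a1 - (xVar (i + 1) - xVar (i + 2)) * c1
  rw [swapVar_braid, ← key2] at key1
  exact (mul_left_cancel₀ (xVar_sub_ne_zero (by omega)) (mul_left_cancel₀
    (xVar_sub_ne_zero (by omega)) (mul_left_cancel₀ (xVar_sub_ne_zero (by omega)) key1))).symm

/-- The composite `∂_1 ∂_2 ⋯ ∂_r`. -/
def divDiffCycle (r : ℕ) (f : XYPoly) : XYPoly :=
  ((List.range r).map (· + 1)).foldr divDiff f

theorem divDiffCycle_succ (r : ℕ) (f : XYPoly) :
    divDiffCycle (r + 1) f = divDiffCycle r (divDiff (r + 1) f) := by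
  simp [divDiffCycle, List.range_succ]

theorem divDiffCycle_apply_zero (r : ℕ) : divDiffCycle r 0 = 0 := by
  induction r with
  | zero => rfl
  | succ r ih => rw [divDiffCycle_succ, divDiff_zero, ih]

theorem divDiffLongest_succ (r : ℕ) (f : XYPoly) :
    divDiffLongest (r + 1) f = divDiffCycle r (divDiffLongest r f) := by
  simp [divDiffLongest, longestWord, divDiffCycle]

theorem divDiff_divDiffCycle_of_lt {r j : ℕ} (h : r + 2 ≤ j) (f : XYPoly) :
    divDiff j (divDiffCycle r f) = divDiffCycle r (divDiff j f) := by
  induction r generalizing f with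
  | zero => rfl
  | succ r ih =>
    rw [divDiffCycle_succ, divDiffCycle_succ, ih (by omega), ← divDiff_comm (by omega)]

theorem divDiff_one_divDiffCycle (r : ℕ) (f : XYPoly) :
    divDiff 1 (divDiffCycle (r + 1) f) = 0 := by
  simp [divDiffCycle, List.range_succ_eq_map]

/-- One braid move at the adjacent letters k, k + 1 of the cycle; all other letters commute with the
factor that passes. -/
theorem divDiff_divDiffCycle {r k : ℕ} (hk : 1 ≤ k) (hkr : k + 1 ≤ r) (f : XYPoly) :
    divDiff (k + 1) (divDiffCycle r f) = divDiffCycle r (divDiff k f) := by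
  induction r generalizing f with
  | zero => omega
  | succ r ih =>
    rcases Nat.lt_or_ge k r with h | h
    · rw [divDiffCycle_succ, divDiffCycle_succ, ih h, divDiff_comm (by omega)]
    · obtain rfl : k = r := by omega
      obtain ⟨q, rfl⟩ : ∃ q, k = q + 1 := ⟨k - 1, by omega⟩
      rw [divDiffCycle_succ, divDiffCycle_succ, divDiff_divDiffCycle_of_lt le_rfl,
        divDiff_braid, divDiffCycle_succ, divDiffCycle_succ]

/-- This makes ∂_{ω_r} f symmetric in x_1, …, x_r. For k = 1 the word begins with ∂_1 and ∂_1² = 0;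
for larger k, passing through the cycle lowers k by one and induction applies. -/
theorem divDiff_divDiffLongest {r k : ℕ} (hk : 1 ≤ k) (hkr : k < r) (f : XYPoly) :
    divDiff k (divDiffLongest r f) = 0 := by
  induction r generalizing k with
  | zero => omega
  | succ r ih =>
    rw [divDiffLongest_succ]
    rcases Nat.eq_or_lt_of_le hk with rfl | h
    · obtain ⟨q, rfl⟩ : ∃ q, r = q + 1 := ⟨r - 1, by omega⟩
      exact divDiff_one_divDiffCycle _ _
    · obtain ⟨q, rfl⟩ : ∃ q, k = q + 1 := ⟨k - 1, by omega⟩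
      rw [divDiff_divDiffCycle (by omega) (by omega), ih (by omega) (by omega),
        divDiffCycle_apply_zero]

theorem mem_longestWord {r i : ℕ} (h : i ∈ longestWord r) : 1 ≤ i ∧ i < r := by
  induction r with
  | zero => simp [longestWord] at h
  | succ r ih =>
    simp only [longestWord, List.mem_append, List.mem_map, List.mem_range] at h
    rcases h with ⟨a, ha, rfl⟩ | h
    · omega
    · have := ih h
      omega

/-! ### The staircase monomial -/

/-- The monomial `x_1^{r-1} x_2^{r-2} ⋯ x_r^0`. -/
def staircase (r : ℕ) : XYPoly := ∏ i ∈ Finset.range r, xVar (i + 1) ^ (r - 1 - i)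

/-- Each ∂_j lowers the exponent of x_j by one, since it sends x_j^{e+1} x_{j+1}^e to (x_j
x_{j+1})^e. At k = r the staircase has shrunk to the one for r. -/
theorem foldl_divDiff_staircase_aux (r k : ℕ) (hk : k ≤ r) :
    ((List.range k).map (· + 1)).foldl (fun u i => divDiff i u) (staircase (r + 1))
      = (∏ i ∈ Finset.range k, xVar (i + 1) ^ (r - 1 - i)) *
        ∏ i ∈ Finset.Ico k (r + 1), xVar (i + 1) ^ (r - i) := by
  induction k with
  | zero => simp [staircase]
  | succ k ih =>
    rw [List.range_succ, List.map_append, List.foldl_append, ih (by omega)]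
    rw [Finset.prod_eq_prod_Ico_succ_bot (by omega : k < r + 1),
      Finset.prod_eq_prod_Ico_succ_bot (by omega : k + 1 < r + 1), Finset.prod_range_succ]
    obtain ⟨e, rfl⟩ : ∃ e, r = k + 1 + e := ⟨r - (k + 1), by omega⟩
    have h1 : k + 1 + e - k = e + 1 := by omega
    have h2 : k + 1 + e - (k + 1) = e := by omega
    have h3 : k + 1 + e - 1 - k = e := by omega
    rw [h1, h2, h3]
    simp only [List.map_cons, List.map_nil, List.foldl_cons, List.foldl_nil]
    set P := ∏ i ∈ Finset.range k, xVar (i + 1) ^ (k + 1 + e - 1 - i) with hP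
    set Q := ∏ i ∈ Finset.Ico (k + 1 + 1) (k + 1 + e + 1), xVar (i + 1) ^ (k + 1 + e - i) with hQ
    have sP : swapVar (k + 1) P = P := by
      rw [hP, map_prod]
      refine Finset.prod_congr rfl fun i hi => ?_
      have := Finset.mem_range.1 hi
      rw [map_pow, swapVar_xVar_of_ne (by omega) (by omega)]
    have sQ : swapVar (k + 1) Q = Q := by
      rw [hQ, map_prod]
      refine Finset.prod_congr rfl fun i hi => ?_
      have := Finset.mem_Ico.1 hi
      rw [map_pow, swapVar_xVar_of_ne (by omega) (by omega)]
    have e1 : P * (xVar (k + 1) ^ (e + 1) * (xVar (k + 1 + 1) ^ e * Q))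
        = (P * Q * (xVar (k + 1) * xVar (k + 1 + 1)) ^ e) * xVar (k + 1) := by ring
    rw [e1, divDiff_mul_of_swapVar_eq, divDiff_xVar]
    · ring
    · rw [map_mul, map_mul, sP, sQ, map_pow, map_mul, swapVar_xVar_left, swapVar_xVar_right,
        mul_comm (xVar (k + 1 + 1))]

theorem foldl_divDiff_staircase (r : ℕ) :
    (longestWord r).foldl (fun u i => divDiff i u) (staircase r) = 1 := by
  induction r with
  | zero => simp [longestWord, staircase]
  | succ r ih =>
    rw [longestWord, List.foldl_append, foldl_divDiff_staircase_aux r r le_rfl]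
    simpa [staircase] using ih

/-! ### Antisymmetrization -/

/-- The embedding of the index set of `x_1, …, x_r` into the natural numbers. -/
def succEmbedding (r : ℕ) : Fin r ↪ ℕ := ⟨fun i => i + 1, fun i j h => Fin.ext (by simpa using h)⟩

@[simp] theorem succEmbedding_apply {r : ℕ} (i : Fin r) : succEmbedding r i = (i : ℕ) + 1 := rfl

/-- The action of a permutation of `x_1, …, x_r`. -/
def permVar {r : ℕ} (σ : Equiv.Perm (Fin r)) : XYPoly →ₐ[ℤ] XYPoly :=
  MvPolynomial.rename (Sum.map (σ.viaEmbedding (succEmbedding r)) id)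

theorem permVar_mul {r : ℕ} (σ τ : Equiv.Perm (Fin r)) (f : XYPoly) :
    permVar (σ * τ) f = permVar σ (permVar τ f) := by
  have : (σ * τ).viaEmbedding (succEmbedding r)
      = σ.viaEmbedding (succEmbedding r) * τ.viaEmbedding (succEmbedding r) :=
    map_mul (Equiv.Perm.viaEmbeddingHom (succEmbedding r)) σ τ
  simp [permVar, MvPolynomial.rename_rename, this, Equiv.Perm.coe_mul]

theorem permVar_one {r : ℕ} (f : XYPoly) : permVar (1 : Equiv.Perm (Fin r)) f = f := by
  have : (1 : Equiv.Perm (Fin r)).viaEmbedding (succEmbedding r) = 1 :=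
    map_one (Equiv.Perm.viaEmbeddingHom (succEmbedding r))
  simp [permVar, this]

@[simp] theorem permVar_xVar {r : ℕ} (σ : Equiv.Perm (Fin r)) (i : Fin r) :
    permVar σ (xVar ((i : ℕ) + 1)) = xVar ((σ i : ℕ) + 1) := by
  have := σ.viaEmbedding_apply (succEmbedding r) i
  simp only [succEmbedding_apply] at this
  simp [permVar, xVar, this]

@[simp] theorem permVar_yVar {r : ℕ} (σ : Equiv.Perm (Fin r)) (j : ℕ) :
    permVar σ (yVar j) = yVar j := by
  simp [permVar, yVar]

theorem swapVar_eq_permVar {n : ℕ} (i : Fin n) :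
    swapVar ((i : ℕ) + 1) = permVar (Equiv.swap i.castSucc i.succ) := by
  have : Equiv.swap ((i : ℕ) + 1) ((i : ℕ) + 1 + 1)
      = (Equiv.swap i.castSucc i.succ).viaEmbedding (succEmbedding (n + 1)) := by
    ext k
    by_cases hk : k ∈ Set.range (succEmbedding (n + 1))
    · obtain ⟨j, rfl⟩ := hk
      rw [Equiv.Perm.viaEmbedding_apply]
      simp only [succEmbedding_apply, Equiv.swap_apply_def, Fin.ext_iff,
        Fin.val_castSucc, Fin.val_succ]
      split_ifs <;> simp_all
    · rw [Equiv.Perm.viaEmbedding_apply_of_notMem _ _ _ hk, Equiv.swap_apply_of_ne_of_ne]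
      · rintro rfl
        exact hk ⟨i.castSucc, by simp⟩
      · rintro rfl
        exact hk ⟨i.succ, by simp⟩
  rw [swapVar, this, permVar]

theorem permVar_eq_of_swapVar_eq {r : ℕ} {f : XYPoly}
    (h : ∀ k, 1 ≤ k → k < r → swapVar k f = f) (σ : Equiv.Perm (Fin r)) : permVar σ f = f := by
  rcases r with _ | n
  · rw [Subsingleton.elim σ 1, permVar_one]
  · have hσ : σ ∈ Submonoid.closure
        (Set.range fun i : Fin n ↦ Equiv.swap i.castSucc i.succ) := by
      rw [Equiv.Perm.mclosure_swap_castSucc_succ]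
      trivial
    induction hσ using Submonoid.closure_induction with
    | mem τ hτ =>
      obtain ⟨i, rfl⟩ := hτ
      change permVar (Equiv.swap i.castSucc i.succ) f = f
      rw [← swapVar_eq_permVar]
      exact h _ (by omega) (by omega)
    | one => exact permVar_one f
    | mul σ τ _ _ h1 h2 => rw [permVar_mul, h2, h1]

/-- The altSumetrization over the permutations of `x_1, …, x_r`. -/
def altSum (r : ℕ) (f : XYPoly) : XYPoly :=
  ∑ σ : Equiv.Perm (Fin r), ((Equiv.Perm.sign σ : ℤ) : XYPoly) * permVar σ f

theorem altSum_sub (r : ℕ) (f g : XYPoly) :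
    altSum r (f - g) = altSum r f - altSum r g := by
  simp [altSum, mul_sub, Finset.sum_sub_distrib]

theorem altSum_swapVar {r k : ℕ} (hk : 1 ≤ k) (hkr : k < r) (f : XYPoly) :
    altSum r (swapVar k f) = - altSum r f := by
  obtain ⟨n, rfl⟩ : ∃ n, r = n + 1 := ⟨r - 1, by omega⟩
  obtain ⟨i, rfl⟩ : ∃ i : Fin n, k = (i : ℕ) + 1 := ⟨⟨k - 1, by omega⟩, by simp; omega⟩
  rw [swapVar_eq_permVar, altSum, altSum, ← Finset.sum_neg_distrib,
    ← Equiv.sum_comp (Equiv.mulRight (Equiv.swap i.castSucc i.succ))]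
  refine Finset.sum_congr rfl fun σ _ => ?_
  have hne : i.castSucc ≠ i.succ := (Fin.castSucc_lt_succ (i := i)).ne
  simp only [Equiv.coe_mulRight, ← permVar_mul, mul_assoc, Equiv.swap_mul_self, mul_one,
    Equiv.Perm.sign_mul, Equiv.Perm.sign_swap hne]
  simp

theorem altSum_eq_zero {r k : ℕ} (hk : 1 ≤ k) (hkr : k < r) {f : XYPoly}
    (h : swapVar k f = f) : altSum r f = 0 := by
  have := altSum_swapVar hk hkr f
  rw [h] at this
  exact self_eq_neg.1 this

/-- The difference u ∂_k f - (∂_k u) f is (u^{s_k} f - u f^{s_k}) / (x_k - x_{k+1}), which s_k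
fixes, so antisymmetrization kills it. -/
theorem altSum_mul_divDiff {r k : ℕ} (hk : 1 ≤ k) (hkr : k < r) (u f : XYPoly) :
    altSum r (u * divDiff k f) = altSum r (divDiff k u * f) := by
  rw [← sub_eq_zero, ← altSum_sub]
  refine altSum_eq_zero hk hkr ?_
  refine mul_left_cancel₀ (xVar_sub_ne_zero (Nat.succ_ne_self k).symm) ?_
  simp only [map_sub, map_mul, swapVar_divDiff]
  linear_combination (swapVar k f - f) * divDiff_spec k u + (u - swapVar k u) * divDiff_spec k f

theorem altSum_mul_foldr_divDiff {r : ℕ} (l : List ℕ) (hl : ∀ i ∈ l, 1 ≤ i ∧ i < r)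
    (u f : XYPoly) :
    altSum r (u * l.foldr divDiff f)
      = altSum r (l.foldl (fun u i => divDiff i u) u * f) := by
  induction l generalizing u with
  | nil => rfl
  | cons i l ih =>
    have hi := hl i (by simp)
    rw [List.foldr_cons, List.foldl_cons, altSum_mul_divDiff hi.1 hi.2,
      ih fun j hj => hl j (by simp [hj])]

/-- Moving ∂_{ω_r} onto the staircase by adjunction reverses the word and leaves 1; the symmetric
factor ∂_{ω_r} f comes out of the antisymmetrization. -/
theorem altSum_staircase_mul_divDiffLongest (r : ℕ) (f : XYPoly) :
    altSum r (staircase r) * divDiffLongest r f = altSum r f := by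
  have h := altSum_mul_foldr_divDiff (longestWord r) (fun i hi => mem_longestWord hi)
    (staircase r) f
  rw [foldl_divDiff_staircase, one_mul] at h
  rw [← h, ← divDiffLongest, altSum, altSum, Finset.sum_mul]
  refine Finset.sum_congr rfl fun σ _ => ?_
  rw [map_mul, permVar_eq_of_swapVar_eq (f := divDiffLongest r f) fun k h1 h2 =>
    swapVar_eq_of_divDiff (divDiff_divDiffLongest h1 h2 f), mul_assoc]

/-! ### Bialternant formula. -/

theorem altSum_prod {r : ℕ} (φ : Fin r → ℕ → XYPoly)
    (hφ : ∀ (σ : Equiv.Perm (Fin r)) (i j : Fin r),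
      permVar σ (φ i ((j : ℕ) + 1)) = φ i ((σ j : ℕ) + 1)) :
    altSum r (∏ i : Fin r, φ i ((i : ℕ) + 1))
      = (Matrix.of fun k i : Fin r => φ i ((k : ℕ) + 1)).det := by
  rw [Matrix.det_apply', altSum]
  refine Finset.sum_congr rfl fun σ _ => ?_
  rw [map_prod]
  simp [hφ]

/-- The product `(t - y_1) ⋯ (t - y_m)`. -/
def factorialPower (m : ℕ) (t : XYPoly) : XYPoly := ∏ j ∈ Finset.range m, (t - yVar (j + 1))

/-- The Vandermonde determinant of `x_1, …, x_r`. -/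
def xVandermonde (r : ℕ) : XYPoly :=
  (Matrix.vandermonde fun k : Fin r => xVar ((k : ℕ) + 1)).det

/-- The alternant with entries `(x_k - y_1) ⋯ (x_k - y_{m_i})`. -/
def alternant {r : ℕ} (m : Fin r → ℕ) : XYPoly :=
  (Matrix.of fun k i : Fin r => factorialPower (m i) (xVar ((k : ℕ) + 1))).det

/-- The staircase and the dominant polynomial both antisymmetrize to determinants with columns in
reverse order, so the sign of the reversal cancels. -/
theorem grassSchubert_mul_xVandermonde {r : ℕ} (ν : Fin r → ℕ) :
    xVandermonde r * grassSchubert ν = alternant fun i => ν i + i := by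
  have h := altSum_staircase_mul_divDiffLongest r
    (dominantPoly fun i : Fin r => ν i.rev + (i.rev : ℕ))
  have h1 : altSum r (staircase r)
      = (Equiv.Perm.sign (Fin.revPerm : Equiv.Perm (Fin r)) : XYPoly) * xVandermonde r := by
    rw [staircase, Finset.prod_range,
      altSum_prod (fun (i : Fin r) k => xVar k ^ (r - 1 - (i : ℕ))) (by simp), xVandermonde,
      ← Matrix.det_permute']
    congr 1
    ext k i : 1
    simp [Matrix.vandermonde, Fin.val_rev, Nat.sub_sub, add_comm 1]
  have h2 : altSum r (dominantPoly fun i : Fin r => ν i.rev + (i.rev : ℕ))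
      = (Equiv.Perm.sign (Fin.revPerm : Equiv.Perm (Fin r)) : XYPoly) *
        alternant fun i => ν i + i := by
    have := altSum_prod
      (fun (i : Fin r) k => factorialPower (ν i.rev + (i.rev : ℕ)) (xVar k))
      (by simp [factorialPower, map_prod])
    rw [alternant, ← Matrix.det_permute']
    exact this
  rw [h1, h2, mul_assoc] at h
  refine mul_left_cancel₀ ?_ h
  rcases Int.units_eq_one_or (Equiv.Perm.sign (Fin.revPerm : Equiv.Perm (Fin r))) with e | e <;>
    simp [e]

/-! ### Expansion of the alternant along its last row -/

theorem xVandermonde_succ (n : ℕ) :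
    xVandermonde (n + 1) = xVandermonde n * ∏ k : Fin n, (xVar (n + 1) - xVar ((k : ℕ) + 1)) := by
  have h (r : ℕ) (v : Fin r → XYPoly) :
      (Matrix.vandermonde v).det = ∏ j, ∏ i ∈ Finset.Iio j, (v j - v i) := by
    rw [Matrix.det_vandermonde]
    exact Finset.prod_comm' (by simp)
  rw [xVandermonde, xVandermonde, h, h, Fin.prod_univ_castSucc]
  simp [Fin.prod_Iio_castSucc, Fin.Iio_last_eq_map]

theorem xVandermonde_ne_zero (r : ℕ) : xVandermonde r ≠ 0 := by
  rw [xVandermonde, Matrix.det_vandermonde_ne_zero_iff]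
  intro i j h
  exact Fin.ext (by simpa using xVar_injective h)

theorem factorialPower_succ (m : ℕ) (t : XYPoly) :
    factorialPower (m + 1) t = factorialPower m t * (t - yVar (m + 1)) :=
  Finset.prod_range_succ _ _

theorem factorialPower_mul_prod_Ico {m M : ℕ} (h : m ≤ M) (t : XYPoly) :
    factorialPower m t * ∏ j ∈ Finset.Ico m M, (t - yVar (j + 1)) = factorialPower M t :=
  Finset.prod_range_mul_prod_Ico _ h

/-- Writing `(t|s)` for `factorialPower s t`, the coefficient of `(t|s)`, `m ≤ s ≤ M`, in the
quotient of `t ((t|M) - (x - y_{m+1}) ⋯ (x - y_M) (t|m))` by `t - x`. -/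
def branchCoeff (x : XYPoly) (m M s : ℕ) : XYPoly :=
  (if s = M then 1 else if s = m then yVar (m + 1) else x) *
    ∏ j ∈ Finset.Ico (s + 1) M, (x - yVar (j + 1))

/-- Passing from M to M + 1 multiplies the quotient by x - y_{M+1} and adds t (t|M) = (t|M+1) +
y_{M+1} (t|M). The coefficient of (t|M) thus becomes (x - y_{M+1}) + y_{M+1} = x; the factor y_{m+1}
at s = m comes from the base case. -/
theorem sub_mul_sum_branchCoeff (x t : XYPoly) {m M : ℕ} (h : m < M) :
    (t - x) * ∑ s ∈ Finset.Ico m (M + 1), branchCoeff x m M s * factorialPower s t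
      = t * (factorialPower M t
        - (∏ j ∈ Finset.Ico m M, (x - yVar (j + 1))) * factorialPower m t) := by
  induction M, h using Nat.le_induction with
  | base =>
    simp [Finset.sum_Ico_succ_top, branchCoeff, factorialPower_succ]
    ring
  | succ M hM ih =>
    have e : ∑ s ∈ Finset.Ico m M, branchCoeff x m (M + 1) s * factorialPower s t
        = (x - yVar (M + 1)) *
          ∑ s ∈ Finset.Ico m M, branchCoeff x m M s * factorialPower s t := by
      rw [Finset.mul_sum]
      refine Finset.sum_congr rfl fun s hs => ?_
      have hs := Finset.mem_Ico.1 hs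
      rw [branchCoeff, branchCoeff, Finset.prod_Ico_succ_top (by omega),
        if_neg (by omega : s ≠ M + 1), if_neg (by omega : s ≠ M)]
      ring
    have e1 : branchCoeff x m (M + 1) M = x := by
      simp [branchCoeff, show M ≠ m by omega]
    have e2 (M : ℕ) : branchCoeff x m M M = 1 := by simp [branchCoeff]
    rw [Finset.sum_Ico_succ_top (by omega), e2] at ih
    rw [Finset.sum_Ico_succ_top (by omega), Finset.sum_Ico_succ_top (by omega), e, e1, e2,
      Finset.prod_Ico_succ_top (by omega), factorialPower_succ]
    linear_combination (x - yVar (M + 1)) * ih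

theorem alternant_sum {n : ℕ} (S : Fin n → Finset ℕ) (c : Fin n → ℕ → XYPoly) :
    (Matrix.of fun k i : Fin n =>
        ∑ s ∈ S i, c i s * factorialPower s (xVar ((k : ℕ) + 1))).det
      = ∑ s ∈ Fintype.piFinset S, (∏ i, c i (s i)) * alternant s := by
  have h := (Matrix.detRowAlternating (R := XYPoly) (n := Fin n)).toMultilinearMap.map_sum_finset
    (fun i s => fun k : Fin n => c i s * factorialPower s (xVar ((k : ℕ) + 1))) S
  rw [← Matrix.det_transpose]
  refine Eq.trans ?_ (h.trans (Finset.sum_congr rfl fun s _ => ?_))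
  · congr 1
    ext i k : 1
    simp
  · rw [alternant, ← Matrix.det_transpose, ← Matrix.det_mul_column]
    rfl

theorem prod_xVar_mul_alternant {n : ℕ} (m : Fin (n + 1) → ℕ) (hm : StrictMono m) :
    (∏ i : Fin (n + 1), xVar ((i : ℕ) + 1)) * alternant m =
      xVar (n + 1) * factorialPower (m 0) (xVar (n + 1)) *
        (∏ k : Fin n, (xVar (n + 1) - xVar ((k : ℕ) + 1))) *
        ∑ s ∈ Fintype.piFinset fun i : Fin n => Finset.Ico (m i.castSucc) (m i.succ + 1),
          (∏ i, branchCoeff (xVar (n + 1)) (m i.castSucc) (m i.succ) (s i)) * alternant s := by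
  set x := xVar (n + 1) with hx
  rw [alternant, ← Matrix.det_mul_column, ← alternant_sum]
  -- This is the ratio (x|m_{i+1}) / (x|m_i), so subtracting c_i times column i clears the last-row
  -- entry of column i + 1.
  let c : Fin n → XYPoly := fun i => ∏ j ∈ Finset.Ico (m i.castSucc) (m i.succ), (x - yVar (j + 1))
  let N : Matrix (Fin (n + 1)) (Fin (n + 1)) XYPoly := Matrix.of fun k =>
    Fin.cons (xVar ((k : ℕ) + 1) * factorialPower (m 0) (xVar ((k : ℕ) + 1)))
      fun i : Fin n => xVar ((k : ℕ) + 1) * (factorialPower (m i.succ) (xVar ((k : ℕ) + 1))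
        - c i * factorialPower (m i.castSucc) (xVar ((k : ℕ) + 1)))
  have hN : (Matrix.of fun k i : Fin (n + 1) => xVar ((k : ℕ) + 1) *
      Matrix.of (fun k i : Fin (n + 1) => factorialPower (m i) (xVar ((k : ℕ) + 1))) k i).det
        = N.det := by
    refine Matrix.det_eq_of_forall_col_eq_smul_add_pred c (fun k => ?_) fun k i => ?_
    · simp [N]
    · simp only [N, Matrix.of_apply, Fin.cons_succ]
      ring
  rw [hN, Matrix.det_succ_row N (Fin.last n), Fin.sum_univ_succ, Finset.sum_eq_zero, add_zero]
  · have e : (N.submatrix (Fin.last n).succAbove (Fin.succAbove 0)) =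
        Matrix.of fun k i : Fin n => (xVar ((k : ℕ) + 1) - x) *
          (Matrix.of fun k i : Fin n => ∑ s ∈ Finset.Ico (m i.castSucc) (m i.succ + 1),
            branchCoeff x (m i.castSucc) (m i.succ) s *
              factorialPower s (xVar ((k : ℕ) + 1))) k i := by
      ext k i : 1
      simp only [Matrix.of_apply]
      rw [sub_mul_sum_branchCoeff x _ (hm (Fin.castSucc_lt_succ (i := i)))]
      simp [N, c]
    rw [e, Matrix.det_mul_column]
    -- This sign cancels the cofactor sign of the bottom left corner.
    have e2 : ∏ k : Fin n, (xVar ((k : ℕ) + 1) - x)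
        = (-1) ^ n * ∏ k : Fin n, (x - xVar ((k : ℕ) + 1)) := by
      rw [← Fin.prod_const, ← Finset.prod_mul_distrib]
      exact Finset.prod_congr rfl fun k _ => by ring
    have e3 : ((-1 : XYPoly) ^ n) * (-1) ^ n = 1 := by rw [← mul_pow]; simp
    rw [e2]
    simp only [N, Matrix.of_apply, Fin.cons_zero, Fin.val_last, Fin.val_zero, add_zero, ← hx]
    generalize Matrix.det (n := Fin n) (R := XYPoly) _ = D
    linear_combination (x * factorialPower (m 0) x *
      (∏ k : Fin n, (x - xVar ((k : ℕ) + 1))) * D) * e3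
  · intro i _
    have hi : m i.castSucc ≤ m i.succ := (hm (Fin.castSucc_lt_succ (i := i))).le
    have : N (Fin.last n) i.succ = 0 := by
      simp only [N, c, Matrix.of_apply, Fin.cons_succ, Fin.val_last, ← hx]
      rw [mul_comm (∏ j ∈ _, _), factorialPower_mul_prod_Ico hi, sub_self, mul_zero]
    rw [this]
    ring

theorem alternant_eq_zero {r : ℕ} {m : Fin r → ℕ} {i j : Fin r} (hij : i ≠ j) (h : m i = m j) :
    alternant m = 0 :=
  Matrix.det_zero_of_column_eq hij fun k => by simp [h]

/-! ### Ribbons -/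

theorem mem_skewBoxes {r : ℕ} (ζ μ : Fin r → ℕ) (a b : ℕ) :
    (a, b) ∈ skewBoxes ζ μ ↔ ∃ i : Fin r, (i : ℕ) = a ∧ μ i ≤ b ∧ b < ζ i := by
  simp only [skewBoxes, rowDiagram, Finset.mem_sdiff, Finset.mem_biUnion, Finset.mem_univ,
    true_and, Finset.mem_product, Finset.mem_singleton, Finset.mem_range]
  constructor
  · rintro ⟨⟨i, rfl, h⟩, h'⟩
    exact ⟨i, rfl, not_lt.1 fun hlt => h' ⟨i, rfl, hlt⟩, h⟩
  · rintro ⟨i, rfl, h1, h2⟩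
    refine ⟨⟨i, rfl, h2⟩, ?_⟩
    rintro ⟨j, hj, h⟩
    obtain rfl : i = j := Fin.ext hj
    omega

theorem mem_skewBoxes_fin {r : ℕ} (ζ μ : Fin r → ℕ) (i : Fin r) (b : ℕ) :
    ((i : ℕ), b) ∈ skewBoxes ζ μ ↔ μ i ≤ b ∧ b < ζ i := by
  rw [mem_skewBoxes]
  constructor
  · rintro ⟨j, hj, h⟩
    obtain rfl : j = i := Fin.ext hj
    exact h
  · exact fun h => ⟨i, rfl, h⟩

theorem prod_skewBoxes {A : Type*} [CommMonoid A] {r : ℕ} (ζ μ : Fin r → ℕ) (f : ℕ × ℕ → A) :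
    ∏ b ∈ skewBoxes ζ μ, f b = ∏ i : Fin r, ∏ j ∈ Finset.Ico (μ i) (ζ i), f ((i : ℕ), j) := by
  have h : skewBoxes ζ μ =
      Finset.univ.biUnion fun i : Fin r => {(i : ℕ)} ×ˢ Finset.Ico (μ i) (ζ i) := by
    ext ⟨a, b⟩
    rw [mem_skewBoxes]
    simp [eq_comm, and_comm]
  rw [h, Finset.prod_biUnion]
  · exact Finset.prod_congr rfl fun i _ => by rw [Finset.prod_product, Finset.prod_singleton]
  · intro i _ j _ hij
    refine Finset.disjoint_left.2 fun b hb hb' => hij (Fin.ext ?_)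
    simp only [Finset.mem_product, Finset.mem_singleton] at hb hb'
    exact hb.1.symm.trans hb'.1

theorem monotone_padTop {n : ℕ} {μ : Fin n → ℕ} (hμ : Monotone μ) : Monotone (padTop μ) := by
  intro i j hij
  induction i using Fin.cases with
  | zero => simp [padTop]
  | succ i =>
    induction j using Fin.cases with
    | zero => exact absurd hij (by simp)
    | succ j => simpa [padTop] using hμ (Fin.succ_le_succ_iff.1 hij)

/-- Row i of ζ ends in column ν_i, so rows i and i + 1 of ζ/μ share at most that column exactly when
μ_i ≥ ν_i. -/
theorem isRibbon_padTop_iff {n : ℕ} {ν ζ : Fin (n + 1) → ℕ} (hν : Monotone ν)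
    (hζ : ∀ i, ζ i = ν i + 1) {μ : Fin n → ℕ} (hμ : Monotone μ) :
    IsRibbon ζ (padTop μ) ↔ ∀ i : Fin n, ν i.castSucc ≤ μ i ∧ μ i ≤ ν i.succ + 1 := by
  constructor
  · rintro ⟨h1, h2⟩ i
    refine ⟨not_lt.1 fun hlt => h2 ?_, by simpa [padTop, hζ] using h1 i.succ⟩
    have e1 : padTop μ i.castSucc ≤ μ i :=
      monotone_padTop hμ (Fin.castSucc_lt_succ (i := i)).le
    have e2 : ν i.castSucc ≤ ν i.succ := hν (Fin.castSucc_lt_succ (i := i)).le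
    -- The square occupies the last two columns of row i of ζ; the subtraction is exact because μ_i
    -- < ν_i.
    refine ⟨(i.castSucc : ℕ), ν i.castSucc - 1, ?_⟩
    have e3 : ((i.castSucc : ℕ) + 1) = (i.succ : ℕ) := by simp
    simp only [e3, mem_skewBoxes_fin, hζ]
    simp only [padTop, Fin.cons_succ] at e1 ⊢
    omega
  · intro h
    refine ⟨fun i => ?_, ?_⟩
    · induction i using Fin.cases with
      | zero => simp [padTop]
      | succ i => simpa [padTop, hζ] using (h i).2
    · rintro ⟨a, b, -, h2, h3, -⟩
      rw [mem_skewBoxes] at h2 h3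
      obtain ⟨i, rfl, -, hi⟩ := h2
      obtain ⟨j, hj, hj', -⟩ := h3
      induction j using Fin.cases with
      | zero => simp at hj
      | succ j =>
        obtain rfl : i = j.castSucc := Fin.ext (by simpa using hj.symm)
        have := (h j).1
        rw [hζ] at hi
        simp only [padTop, Fin.cons_succ] at hj'
        omega

/-- A telescoping product freed of division: formally T_k = (E_k / E_{k+1}) d_k. -/
theorem prod_eq_of_mul_eq_mul {R : Type*} [CommMonoid R] {n : ℕ} (T E : Fin (n + 1) → R)
    (d : Fin n → R) (h : ∀ k : Fin n, T k.castSucc * E k.succ = E k.castSucc * d k)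
    (hlast : T (Fin.last n) = E (Fin.last n)) : ∏ i, T i = E 0 * ∏ k, d k := by
  induction n with
  | zero => simpa using hlast
  | succ n ih =>
    have h0 : T 0 * E (Fin.succ 0) = E 0 * d 0 := h 0
    rw [Fin.prod_univ_succ, Fin.prod_univ_succ (f := d),
      ih (fun i => T i.succ) (fun i => E i.succ) (fun k => d k.succ) (fun k => h k.succ) hlast,
      ← mul_assoc, h0, mul_assoc]

open Classical in
theorem prod_row_boxWeight {r : ℕ} {ν ζ μ : Fin r → ℕ} (hζ : ∀ i, ζ i = ν i + 1) (x : XYPoly)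
    (i : Fin r) :
    ∏ j ∈ Finset.Ico (μ i) (ζ i), boxWeight x yVar ζ μ ((i : ℕ), j)
      = (∏ j ∈ Finset.Ico (μ i) (ν i), (x - yVar ((i : ℕ) + j + 1))) *
        if μ i ≤ ν i then
          if ((i : ℕ) + 1, ν i) ∈ skewBoxes ζ μ then yVar ((i : ℕ) + ν i + 1) else x
        else 1 := by
  by_cases h : μ i ≤ ν i
  · rw [if_pos h, hζ, Finset.prod_Ico_succ_top h]
    congr 1
    · refine Finset.prod_congr rfl fun j hj => ?_
      have hj := Finset.mem_Ico.1 hj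
      rw [boxWeight, if_pos]
      · rfl
      · intro ht
        have := ht ((i : ℕ), ν i) ((mem_skewBoxes_fin _ _ _ _).2 ⟨h, by rw [hζ]; omega⟩) rfl
        simp only at this
        omega
    · rw [boxWeight, if_neg]
      · rfl
      · rw [not_not]
        rintro ⟨a, b⟩ hb rfl
        have := (mem_skewBoxes_fin _ _ _ _).1 hb
        rw [hζ] at this
        simp only
        omega
  · rw [if_neg h, hζ, Finset.Ico_eq_empty (by omega), Finset.Ico_eq_empty (by omega)]
    simp

/-- Nonterminal boxes give the products of x - y_j on both sides. The terminal factors are grouped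
differently: `branchCoeff` takes the value 1 when the lower of two adjacent rows is empty, whereas
the weight assigns 1 to each empty row itself. -/
theorem ribbonWeight_padTop {n : ℕ} {ν ζ : Fin (n + 1) → ℕ} (hν : Monotone ν)
    (hζ : ∀ i, ζ i = ν i + 1) {μ : Fin n → ℕ} (hμ : Monotone μ)
    (h : ∀ i : Fin n, ν i.castSucc ≤ μ i ∧ μ i ≤ ν i.succ + 1) (x : XYPoly) :
    ribbonWeight x yVar ζ (padTop μ) = x * factorialPower (ν 0) x *
      ∏ i : Fin n, branchCoeff x (ν i.castSucc + (i.castSucc : ℕ)) (ν i.succ + (i.succ : ℕ))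
        (μ i + i) := by
  classical
  rw [ribbonWeight, prod_skewBoxes, Finset.prod_congr rfl fun i _ => prod_row_boxWeight hζ x i,
    Finset.prod_mul_distrib]
  simp only [branchCoeff]
  -- With E_k equal to x on nonempty rows and 1 on empty ones, T_k = E_k and d_k = E_{k+1}, unless
  -- the terminal box of row k lies above a box; then T_k = d_k = y and E_k = E_{k+1} = x.
  rw [Finset.prod_mul_distrib, Fin.prod_univ_succ (n := n), prod_eq_of_mul_eq_mul (n := n) _
    (fun i => if padTop μ i ≤ ν i then x else 1)
    (fun i : Fin n => if μ i + (i : ℕ) = ν i.succ + (i.succ : ℕ) then 1 else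
      if μ i + (i : ℕ) = ν i.castSucc + (i.castSucc : ℕ) then
        yVar (ν i.castSucc + (i.castSucc : ℕ) + 1) else x)]
  · have e0 : ∏ j ∈ Finset.Ico (padTop μ 0) (ν 0), (x - yVar (((0 : Fin (n + 1)) : ℕ) + j + 1))
        = factorialPower (ν 0) x := by
      simp [padTop, factorialPower]
    have e1 (i : Fin n) : ∏ j ∈ Finset.Ico (padTop μ i.succ) (ν i.succ),
          (x - yVar ((i.succ : ℕ) + j + 1))
        = ∏ j ∈ Finset.Ico (μ i + (i : ℕ) + 1) (ν i.succ + (i.succ : ℕ)),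
          (x - yVar (j + 1)) := by
      rw [Fin.val_succ, add_assoc (μ i), ← Finset.prod_Ico_add']
      refine Finset.prod_congr rfl fun j _ => ?_
      rw [add_comm j]
    rw [e0, Finset.prod_congr rfl fun i _ => e1 i]
    have e2 : padTop μ 0 ≤ ν 0 := by simp [padTop]
    rw [if_pos e2]
    ring
  · intro i
    have hi := h i
    have e2 : ν i.castSucc ≤ ν i.succ := hν (Fin.castSucc_lt_succ (i := i)).le
    have e3 : ((i.castSucc : ℕ) + 1) = (i.succ : ℕ) := by simp
    have e4 : padTop μ i.castSucc ≤ μ i :=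
      monotone_padTop hμ (Fin.castSucc_lt_succ (i := i)).le
    have e5 : padTop μ i.succ = μ i := rfl
    simp only [e3, mem_skewBoxes_fin, hζ, e5]
    simp only [Fin.val_castSucc, Fin.val_succ]
    by_cases c1 : μ i = ν i.castSucc
    · rw [if_pos (by omega), if_pos (by omega), if_pos (by omega), if_pos (by omega),
        if_neg (by omega), if_pos (by omega), add_comm (i : ℕ), mul_comm]
    · rw [if_neg (by omega : ¬ (μ i ≤ ν i.castSucc ∧ ν i.castSucc < ν i.succ + 1))]
      congr 1
      split_ifs <;> first | rfl | omega
  -- Nothing lies below the bottom row.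
  · rw [if_neg (c := _ ∈ skewBoxes _ _)]
    rw [mem_skewBoxes]
    rintro ⟨i, hi, -⟩
    have := i.2
    simp only [Fin.val_last] at hi
    omega

theorem sum_ribbonPartitions {n : ℕ} {ν ζ : Fin (n + 1) → ℕ} (hν : Monotone ν)
    (hζ : ∀ i, ζ i = ν i + 1) (x : XYPoly) :
    ∑ μ ∈ (ribbonPartitions_finite ζ).toFinset,
        ribbonWeight x yVar ζ (padTop μ) * alternant (fun i => μ i + i) =
      x * factorialPower (ν 0) x *
        ∑ s ∈ Fintype.piFinset fun i : Fin n =>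
            Finset.Ico (ν i.castSucc + (i.castSucc : ℕ)) (ν i.succ + (i.succ : ℕ) + 1),
          (∏ i, branchCoeff x (ν i.castSucc + (i.castSucc : ℕ)) (ν i.succ + (i.succ : ℕ)) (s i))
            * alternant s := by
  rw [Finset.mul_sum]
  have hmem (μ : Fin n → ℕ) : μ ∈ (ribbonPartitions_finite ζ).toFinset ↔
      Monotone μ ∧ ∀ i : Fin n, ν i.castSucc ≤ μ i ∧ μ i ≤ ν i.succ + 1 := by
    rw [Set.Finite.mem_toFinset, ribbonPartitions, Set.mem_ofPred_eq]
    exact and_congr_right fun hμ => isRibbon_padTop_iff hν hζ hμ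
  refine Finset.sum_of_injOn (fun μ i => μ i + (i : ℕ)) ?_ ?_ ?_ ?_
  · intro μ _ μ' _ e
    funext i
    simpa using congrFun e i
  · intro μ hμ
    have hμ := (hmem μ).1 hμ
    simp only [Finset.mem_coe, Fintype.mem_piFinset, Finset.mem_Ico, Fin.val_castSucc,
      Fin.val_succ]
    intro i
    have := hμ.2 i
    omega
  · intro s hs hs'
    simp only [Fintype.mem_piFinset, Finset.mem_Ico, Fin.val_castSucc, Fin.val_succ] at hs
    -- Consecutive ranges for s share only an endpoint, so an injective s is strictly increasing and
    -- s_i - i is a partition; otherwise two columns of the alternant coincide.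
    by_cases hinj : Function.Injective s
    · refine absurd ⟨fun i => s i - i, ?_, ?_⟩ hs'
      · refine (hmem _).2 ⟨?_, fun i => by have := hs i; omega⟩
        rcases n with _ | q
        · exact Subsingleton.monotone _
        · refine Fin.monotone_iff_le_succ.2 fun i => ?_
          have h1 := hs i.castSucc
          have h2 := hs i.succ
          have h3 : s i.castSucc ≠ s i.succ :=
            fun e => (Fin.castSucc_lt_succ (i := i)).ne (hinj e)
          simp only [Fin.succ_castSucc, Fin.val_castSucc, Fin.val_succ] at h1 h2 ⊢
          omega
      · funext i
        have := hs i
        simp only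
        omega
    · simp only [Function.Injective, not_forall] at hinj
      obtain ⟨i, j, e, hij⟩ := hinj
      rw [alternant_eq_zero hij e, mul_zero, mul_zero]
  · intro μ hμ
    have hμ := (hmem μ).1 hμ
    rw [ribbonWeight_padTop hν hζ hμ.1 hμ.2]
    ring

end

/-! ### Conclusion: cancelling the Vandermonde determinant. -/

theorem mainTheorem4 (n : ℕ) (ν : Fin (n + 1) → ℕ) (hν : Monotone ν)
    (ζ : Fin (n + 1) → ℕ) (hζ : ∀ i, ζ i = ν i + 1) :
    (∏ i : Fin (n + 1), xVar ((i : ℕ) + 1)) * grassSchubert ν =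
      ∑ μ ∈ (ribbonPartitions_finite ζ).toFinset,
        ribbonWeight (xVar (n + 1)) yVar ζ (padTop μ) * grassSchubert μ := by
  have hm : StrictMono fun i : Fin (n + 1) => ν i + (i : ℕ) := fun i j hij =>
    add_lt_add_of_le_of_lt (hν hij.le) hij
  have h1 := grassSchubert_mul_xVandermonde ν
  have h2 := prod_xVar_mul_alternant _ hm
  have h3 := sum_ribbonPartitions hν hζ (xVar (n + 1))
  have h4 : xVandermonde n * ∑ μ ∈ (ribbonPartitions_finite ζ).toFinset,
        ribbonWeight (xVar (n + 1)) yVar ζ (padTop μ) * grassSchubert μ =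
      ∑ μ ∈ (ribbonPartitions_finite ζ).toFinset,
        ribbonWeight (xVar (n + 1)) yVar ζ (padTop μ) * alternant (fun i => μ i + i) := by
    rw [Finset.mul_sum]
    refine Finset.sum_congr rfl fun μ _ => ?_
    rw [← grassSchubert_mul_xVandermonde]
    ring
  simp only [Fin.val_zero, add_zero] at h2
  refine mul_left_cancel₀ (xVandermonde_ne_zero (n + 1)) ?_
  rw [mul_left_comm, h1, h2, xVandermonde_succ, mul_right_comm (xVandermonde n), h4, h3]
  ring
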